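/- Let $G=(V,E)$ be a finite simple graph of maximum degree $\Delta\ge 3$, let $\delta\in(0,1)$, and let $\beta,\gamma,\lambda$ be real numbers with $0\le\beta\le\gamma$, $\gamma>0$, $\lambda>0$ and $\beta\gamma<1$. Let $\mu$ be the Gibbs distribution on $\{0,1\}^V$ of the antiferromagnetic two-spin system with parameters $(\beta,\gamma,\lambda)$, that is, $$\mu(\sigma)\propto \beta^{m_1(\sigma)}\gamma^{m_0(\sigma)}\lambda^{\|\sigma\|},$$ where $m_b(\sigma)$ is the number of edges both of whose endpoints have spin $b$, $\|\sigma\|$ is the number of vertices with spin $1$, and $0^0=1$. For an integer $d\ge1$ let $f_d(x)=\lambda\left(\frac{\beta x+1}{x+\gamma}\right)^d$, and let $\hat x_d$ be its unique positive fixed point. Say that $(\beta,\gamma,\lambda)$ is $d$-unique with slack $\delta$ if $$|f_d'(\hat x_d)|=\frac{d(1-\beta\gamma)\hat x_d}{(\beta\hat x_d+1)(\hat x_d+\gamma)}\le 1-\delta .$$ Assume that - if $\gamma\le1$, then $(\beta,\gamma,\lambda)$ is $(\Delta-1)$-unique with slack $\delta$; - if $\gamma>1$, then $(\beta,\gamma,\lambda)$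 is $(\Delta-1)$-unique with slack $\delta$, and $G$ is $\Delta$-regular. For a distribution $\nu$ on $\{0,1\}^V$ and $X\sim\nu$, define the influence matrix $\Psi_\nu\in\mathbb R^{V\times V}$ by $\Psi_\nu(u,v)=\Pr[X_v=1\mid X_u=1]-\Pr[X_v=1\mid X_u=0]$ if $\mathbb E[X_u]\in(0,1)$ and $u\ne v$, and $\Psi_\nu(u,v)=0$ otherwise. For $\Lambda\subseteq V$ and $\tau\in\{0,1\}^\Lambda$ with $\Pr_{X\sim\mu}[X_\Lambda=\tau]>0$ (a feasible pinning), let $\mu^\tau$ be $\mu$ conditioned on $X_\Lambda=\tau$. Then for every feasible pinning $\tau$, all eigenvalues of $\Psi_{\mu^\tau}$ are real, and its largest eigenvalue satisfies $$\lambda_{\max}(\Psi_{\mu^\tau})\le\frac{\Delta(1-\delta)}{(\Delta-1)\delta}.$$ -/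

import Mathlib

namespace TwoSpin

/-- The parameter range `0 ≤ β ≤ γ`, `γ > 0`, `λ > 0`, `β γ < 1` of antiferromagnetic two-spin
systems (with the two spins labelled so that `β ≤ γ`). -/
structure IsAntiferromagnetic (β γ lam : ℝ) : Prop where
  beta_nonneg : 0 ≤ β
  beta_le_gamma : β ≤ γ
  gamma_pos : 0 < γ
  lam_pos : 0 < lam
  mul_lt_one : β * γ < 1

/-- The symmetric tree recursion `f_d(x) = λ ((β x + 1) / (x + γ)) ^ d`. -/
noncomputable def treeRec (β γ lam : ℝ) (d : ℕ) (x : ℝ) : ℝ :=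
  lam * ((β * x + 1) / (x + γ)) ^ d

/-- `f_d` has exactly one positive fixed point. -/
theorem existsUnique_fixedPoint {β γ lam : ℝ} (h : IsAntiferromagnetic β γ lam) (d : ℕ) :
    ∃! x : ℝ, 0 < x ∧ treeRec β γ lam d x = x := by
  obtain ⟨hβ, -, hγ, hlam, hlt⟩ := h
  have hpos : ∀ x : ℝ, 0 ≤ x → 0 < treeRec β γ lam d x := by
    intro x hx
    unfold treeRec
    positivity
  have hanti : ∀ x y : ℝ, 0 ≤ x → x ≤ y → treeRec β γ lam d y ≤ treeRec β γ lam d x := by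
    intro x y hx hxy
    have hy : 0 ≤ y := hx.trans hxy
    unfold treeRec
    refine mul_le_mul_of_nonneg_left (pow_le_pow_left₀ (by positivity) ?_ d) hlam.le
    rw [div_le_div_iff₀ (by positivity) (by positivity)]
    nlinarith [mul_nonneg (sub_nonneg.2 hxy) (sub_nonneg.2 hlt.le)]
  have hcont : ContinuousOn (fun x => treeRec β γ lam d x - x)
      (Set.Icc 0 (treeRec β γ lam d 0)) := by
    unfold treeRec
    refine ContinuousOn.sub (ContinuousOn.mul continuousOn_const
      (ContinuousOn.pow (ContinuousOn.div (by fun_prop) (by fun_prop) ?_) d)) continuousOn_id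
    intro x hx
    have := hx.1
    positivity
  have h0 := hpos 0 le_rfl
  obtain ⟨x, hx, hfx⟩ := intermediate_value_Icc' h0.le hcont
    (show (0 : ℝ) ∈ Set.Icc _ _ from
      ⟨sub_nonpos.2 (hanti _ _ le_rfl h0.le), by simpa using h0.le⟩)
  have hfx' : treeRec β γ lam d x = x := sub_eq_zero.1 hfx
  have hx0 : 0 < x := hfx' ▸ hpos x hx.1
  refine ⟨x, ⟨hx0, hfx'⟩, ?_⟩
  rintro y ⟨hy0, hfy⟩
  rcases le_total x y with hxy | hxy
  · have := hanti x y hx0.le hxy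
    linarith
  · have := hanti y x hy0.le hxy
    linarith

/-- `(β, γ, λ)` is `d`-unique with slack `δ`: `|f_d'(x̂)| ≤ 1 - δ` at the positive fixed point `x̂`
of `f_d`, which exists and is unique for antiferromagnetic parameters. -/
def IsUniqueWithSlack (β γ lam : ℝ) (d : ℕ) (δ : ℝ) : Prop :=
  ∃ x : ℝ, 0 < x ∧ treeRec β γ lam d x = x ∧ |deriv (treeRec β γ lam d) x| ≤ 1 - δ

/-- The closed form of the derivative at the fixed point. -/
theorem abs_deriv_treeRec {β γ lam : ℝ} (h : IsAntiferromagnetic β γ lam) (d : ℕ) {x : ℝ}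
    (hx : 0 < x) (hfx : treeRec β γ lam d x = x) :
    |deriv (treeRec β γ lam d) x| = d * (1 - β * γ) * x / ((β * x + 1) * (x + γ)) := by
  obtain ⟨hβ, -, hγ, hlam, hlt⟩ := h
  have hne : x + γ ≠ 0 := by positivity
  have hne' : β * x + 1 ≠ 0 := by positivity
  have hd : HasDerivAt (treeRec β γ lam d)
      (-(d * (1 - β * γ) * x / ((β * x + 1) * (x + γ)))) x := by
    have h1 : HasDerivAt (fun y : ℝ => (β * y + 1) / (y + γ))
        ((β * (x + γ) - (β * x + 1) * 1) / (x + γ) ^ 2) x := by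
      refine HasDerivAt.div ?_ ((hasDerivAt_id x).add_const γ) hne
      simpa using ((hasDerivAt_id x).const_mul β).add_const 1
    refine ((h1.pow d).const_mul lam).congr_deriv ?_
    rcases Nat.eq_zero_or_pos d with rfl | hd
    · simp
    · obtain ⟨k, rfl⟩ := Nat.exists_eq_succ_of_ne_zero hd.ne'
      have hfx2 : x = lam * ((β * x + 1) / (x + γ)) ^ k * ((β * x + 1) / (x + γ)) := by
        conv_lhs => rw [← hfx]
        rw [treeRec, pow_succ]
        ring
      have hk : lam * ((β * x + 1) / (x + γ)) ^ k = x * (x + γ) / (β * x + 1) := by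
        rw [eq_div_iff hne']
        field_simp at hfx2
        linear_combination -hfx2
      simp only [Nat.succ_eq_add_one, Nat.add_sub_cancel]
      have : ∀ a b c e : ℝ, a * (b * c * e) = (a * c) * b * e := by intros; ring
      rw [this, hk]
      field_simp
      ring
  rw [hd.deriv, abs_neg, abs_of_nonneg]
  have : 0 ≤ 1 - β * γ := by linarith
  positivity

section Distributions

variable {V : Type*} [Fintype V]

/-- Probability of an event `A` under a distribution on `{0,1}^V` given by its mass function;
the spin `1` is `true` and the spin `0` is `false`. -/
noncomputable def prob (μ : (V → Bool) → ℝ) (A : Set (V → Bool)) : ℝ :=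
  open Classical in ∑ σ with σ ∈ A, μ σ

/-- The conditional distribution `μ(· ∣ A)`. -/
noncomputable def condDist (μ : (V → Bool) → ℝ) (A : Set (V → Bool)) : (V → Bool) → ℝ :=
  fun σ => A.indicator μ σ / prob μ A

/-- The event that the spin of `v` is `b`. -/
def spinEvent (v : V) (b : Bool) : Set (V → Bool) := {σ | σ v = b}

/-- The event that the configuration agrees with the partial configuration `τ ∈ {0,1}^Λ`. -/
def pinEvent {Λ : Set V} (τ : Λ → Bool) : Set (V → Bool) := {σ | ∀ v : Λ, σ v = τ v}

/-- A pinning `τ` is feasible if `μ_Λ(τ) > 0`. -/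
def IsFeasible (μ : (V → Bool) → ℝ) {Λ : Set V} (τ : Λ → Bool) : Prop :=
  0 < prob μ (pinEvent τ)

/-- The pinned distribution `μ^τ`, i.e. `μ` conditioned on agreement with `τ`. -/
noncomputable def pinned (μ : (V → Bool) → ℝ) {Λ : Set V} (τ : Λ → Bool) : (V → Bool) → ℝ :=
  condDist μ (pinEvent τ)

/-- The influence matrix: `Ψ_μ(u,v) = Pr[X_v = 1 ∣ X_u = 1] - Pr[X_v = 1 ∣ X_u = 0]` if
`0 < E[X_u] = Pr[X_u = 1] < 1` and `u ≠ v`, and `0` otherwise. -/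
noncomputable def influenceMatrix (μ : (V → Bool) → ℝ) : Matrix V V ℝ :=
  open Classical in Matrix.of fun u v =>
    if prob μ (spinEvent u true) ∈ Set.Ioo (0 : ℝ) 1 ∧ u ≠ v then
      prob (condDist μ (spinEvent u true)) (spinEvent v true) -
        prob (condDist μ (spinEvent u false)) (spinEvent v true)
    else 0

/-- The largest real eigenvalue of a square matrix. -/
noncomputable def lambdaMax [DecidableEq V] (A : Matrix V V ℝ) : ℝ := sSup (spectrum ℝ A)

end Distributions

section Gibbs

variable {V : Type*} [Fintype V] [DecidableEq V] (G : SimpleGraph V) [DecidableRel G.Adj]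

/-- `m_b(σ)`: the number of edges both of whose endpoints have spin `b`. -/
def monoEdges (b : Bool) (σ : V → Bool) : ℕ :=
  (G.edgeFinset.filter fun e => ∀ v ∈ e, σ v = b).card

/-- The unnormalized weight `β^{m_1(σ)} γ^{m_0(σ)} λ^{‖σ‖}`. -/
def weight (β γ lam : ℝ) (σ : V → Bool) : ℝ :=
  β ^ monoEdges G true σ * γ ^ monoEdges G false σ *
    lam ^ (Finset.univ.filter fun v => σ v = true).card

/-- The Gibbs distribution (as a mass function) of the two-spin system on `G`. -/
noncomputable def gibbs (β γ lam : ℝ) (σ : V → Bool) : ℝ :=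
  weight G β γ lam σ / ∑ ω, weight G β γ lam ω

/-- The Gibbs mass function of an antiferromagnetic system is a probability distribution. -/
theorem gibbs_isProbability {β γ lam : ℝ} (h : IsAntiferromagnetic β γ lam) :
    (∀ σ, 0 ≤ gibbs G β γ lam σ) ∧ ∑ σ, gibbs G β γ lam σ = 1 := by
  obtain ⟨hβ, -, hγ, hlam, -⟩ := h
  have hw : ∀ σ, 0 ≤ weight G β γ lam σ := fun σ => by unfold weight; positivity
  have h0 : 0 < weight G β γ lam (fun _ => false) := by
    have : monoEdges G true (fun _ : V => false) = 0 := by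
      rw [monoEdges, Finset.card_eq_zero, Finset.filter_eq_empty_iff]
      intro e _ he
      induction e with
      | _ a b => exact absurd (he a (Sym2.mem_mk_left a b)) (by simp)
    unfold weight
    rw [this]
    positivity
  have hZ : 0 < ∑ ω, weight G β γ lam ω :=
    Finset.sum_pos' (fun σ _ => hw σ) ⟨_, Finset.mem_univ _, h0⟩
  refine ⟨fun σ => div_nonneg (hw σ) hZ.le, ?_⟩
  unfold gibbs
  rw [← Finset.sum_div, div_self hZ.ne']

end Gibbs

end TwoSpin

/-!
The eigenvalues are real because `Ψ` is diagonally similar to the symmetric matrix of correlations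
(`splits_charpoly_influenceMatrix`). By Gershgorin's theorem the largest one is at most the largest
absolute row sum, so it suffices to bound the total influence of each vertex `u`.

*Recursion.* After conditioning on the spin of `u`, each neighbour of `u` carries a pinned copy of
`u`. Switching these copies from `0` to `1` one neighbour at a time changes the marginals, at each
step, by the influences of a neighbour `x` in a system without the edges at `u`, multiplied by
`-h(R_x)`, and multiplies the partition function by `g(R_x)`. Here `R_x` denotes the odds of spin `1`
at `x`, `g(x) = (β x + 1) / (x + γ)` and `h(x) = (1 - β γ) x / ((β x + 1) (x + γ))`. Hence the
influences obey the recursion of the tree of self-avoiding walks, with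
`R_u = λ β ^ p γ ^ (-q) ∏ g(R_x)` when `u` has `p` and `q` neighbours pinned to `1` and `0`
(`exists_child_odds`). All systems that occur have vertices of degree at most `Δ`, and at most
`d = Δ - 1` at the root of a subtree (`IsContext`, `HasDegree`).

*Contraction over two levels.* Let `z` be the fixed point of the tree recursion and
`κ = d h(z) ≤ 1 - δ`. For the root of a subtree let `S` be its total influence on the subtree,
itself included. By induction `h(R) S ≤ h(z) / (1 - κ)` (`influenceBound`). Indeed this bound for the
children gives `S ≤ 1 + κ / (1 - κ) = 1 / (1 - κ)` for their parent. Applied to the children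
themselves, the latter estimate gives `S ≤ 1 + (1 - κ)⁻¹ ∑ h(R_x)`, so that it remains to see that
`h(R) (1 + (1 - κ)⁻¹ ∑ h(R_x))` is largest when all odds are equal to `z`
(`edgeInfluence_mul_le`). This holds since `h` is concave as a function of `log g`, and `log h(y)` is
concave as a function of `log y`, and the two tangent lines at `z` have opposite slopes, so that
their contributions cancel. A missing child counts as one with `g = 1` and `h = 0`, which the tangent
line allows when `γ ≤ 1`; for `γ > 1` regularity rules it out. Summing over the at most `Δ`
neighbours of `u` gives the total influence at most `Δ h(z) / (1 - κ)`, which is the claim.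
-/

namespace TwoSpin

/-! ### Contraction at one vertex of the tree -/

/-- The factor `(β x + 1) / (x + γ)` by which a child whose odds of spin `1` are `x` multiplies the
odds of its parent. -/
noncomputable def oddsFactor (β γ x : ℝ) : ℝ := (β * x + 1) / (x + γ)

/-- The absolute influence of a parent on a child whose odds of spin `1` (without the parent)
are `x`. -/
noncomputable def edgeInfluence (β γ x : ℝ) : ℝ :=
  (1 - β * γ) * x / ((β * x + 1) * (x + γ))

theorem oddsFactor_pos {β γ x : ℝ} (hβ : 0 ≤ β) (hγ : 0 < γ) (hx : 0 ≤ x) :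
    0 < oddsFactor β γ x := by
  unfold oddsFactor; positivity

theorem edgeInfluence_nonneg {β γ x : ℝ} (hβ : 0 ≤ β) (hγ : 0 < γ) (hlt : β * γ < 1)
    (hx : 0 ≤ x) : 0 ≤ edgeInfluence β γ x := by
  have : 0 ≤ 1 - β * γ := by linarith
  unfold edgeInfluence; positivity

/-- In terms of the odds factor `g`, the influence is a concave function of `log g`. -/
theorem edgeInfluence_eq_of_oddsFactor {β γ x : ℝ} (hβ : 0 ≤ β) (hγ : 0 < γ) (hlt : β * γ < 1)
    (hx : 0 ≤ x) : edgeInfluence β γ x =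
      (1 + β * γ - γ * oddsFactor β γ x - β / oddsFactor β γ x) / (1 - β * γ) := by
  have h1 : β * x + 1 ≠ 0 := by positivity
  have h2 : x + γ ≠ 0 := by positivity
  have h3 : 1 - β * γ ≠ 0 := by linarith
  unfold edgeInfluence oddsFactor
  field_simp
  ring

/-- The logarithmic derivative of `edgeInfluence β γ` at `x`. -/
noncomputable def influenceSlope (β γ x : ℝ) : ℝ := γ / (x + γ) - β * x / (β * x + 1)

/-- Concavity of the influence as a function of the logarithm of the odds factor: it lies below its
tangent line. -/
theorem influence_le_tangent {β γ z t : ℝ} (hβ : 0 ≤ β) (hγ : 0 < γ) (hlt : β * γ < 1)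
    (hz : 0 < z) (ht : 0 < t) :
    (1 + β * γ - γ * t - β / t) / (1 - β * γ) ≤ edgeInfluence β γ z -
      influenceSlope β γ z * (Real.log t - Real.log (oddsFactor β γ z)) := by
  have hg := oddsFactor_pos hβ hγ hz.le
  have h1 : β * z + 1 ≠ 0 := by positivity
  have h2 : z + γ ≠ 0 := by positivity
  have h3 : 0 < 1 - β * γ := by linarith
  have hs : influenceSlope β γ z =
      (γ * oddsFactor β γ z - β / oddsFactor β γ z) / (1 - β * γ) := by
    rw [eq_div_iff h3.ne']
    unfold influenceSlope oddsFactor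
    field_simp
    ring
  rw [edgeInfluence_eq_of_oddsFactor hβ hγ hlt hz.le, hs]
  set g := oddsFactor β γ z
  have e1 : Real.log (t / g) ≤ t / g - 1 := Real.log_le_sub_one_of_pos (by positivity)
  have e2 : Real.log (g / t) ≤ g / t - 1 := Real.log_le_sub_one_of_pos (by positivity)
  rw [Real.log_div ht.ne' hg.ne'] at e1
  rw [Real.log_div hg.ne' ht.ne'] at e2
  rw [div_mul_eq_mul_div, ← sub_div, div_le_div_iff_of_pos_right h3]
  have f1 : γ * g * (Real.log t - Real.log g) ≤ γ * t - γ * g := by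
    calc γ * g * (Real.log t - Real.log g) ≤ γ * g * (t / g - 1) := by gcongr
      _ = γ * t - γ * g := by field_simp
  have f2 : β / g * (Real.log g - Real.log t) ≤ β / t - β / g := by
    calc β / g * (Real.log g - Real.log t) ≤ β / g * (g / t - 1) := by gcongr
      _ = β / t - β / g := by field_simp
  linarith [sub_mul (γ * g) (β / g) (Real.log t - Real.log g)]

/-- The influence is log-concave in the logarithm of the odds. -/
theorem log_edgeInfluence_le_tangent {β γ z y : ℝ} (hβ : 0 ≤ β) (hγ : 0 < γ) (hlt : β * γ < 1)
    (hz : 0 < z) (hy : 0 < y) :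
    Real.log (edgeInfluence β γ y) ≤ Real.log (edgeInfluence β γ z) +
      influenceSlope β γ z * (Real.log y - Real.log z) := by
  have h3 : 0 < 1 - β * γ := by linarith
  have key : ∀ a b : ℝ, 0 ≤ a → 0 < b →
      a * z / (a * z + b) * (Real.log y - Real.log z) ≤
        Real.log (a * y + b) - Real.log (a * z + b) := by
    intro a b ha hb
    have hz' : 0 < a * z + b := by positivity
    have hy' : 0 < a * y + b := by positivity
    have := Real.geom_mean_le_arith_mean2_weighted (w₁ := a * z / (a * z + b))
      (w₂ := b / (a * z + b)) (p₁ := y / z) (p₂ := 1) (by positivity) (by positivity)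
      (by positivity) (by positivity) (by field_simp)
    rw [Real.one_rpow, mul_one, mul_one] at this
    have h := Real.log_le_log (Real.rpow_pos_of_pos (by positivity) _) this
    rw [Real.log_rpow (by positivity), Real.log_div hy.ne' hz.ne'] at h
    rw [← Real.log_div hy'.ne' hz'.ne']
    refine h.trans_eq (congrArg Real.log ?_)
    field_simp
  have k1 := key β 1 hβ one_pos
  have k2 := key 1 γ zero_le_one hγ
  simp only [one_mul] at k2
  have hlog : ∀ x : ℝ, 0 < x → Real.log (edgeInfluence β γ x) =
      Real.log (1 - β * γ) + Real.log x - Real.log (β * x + 1) - Real.log (x + γ) := by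
    intro x hx
    have : 0 < β * x + 1 := by positivity
    have : 0 < x + γ := by positivity
    rw [edgeInfluence, Real.log_div (by positivity) (by positivity),
      Real.log_mul h3.ne' hx.ne', Real.log_mul (by positivity) (by positivity)]
    ring
  have hs : influenceSlope β γ z = 1 - β * z / (β * z + 1) - z / (z + γ) := by
    unfold influenceSlope
    field_simp
    ring
  rw [hlog y hy, hlog z hz, hs]
  linarith [sub_mul (1 - β * z / (β * z + 1)) (z / (z + γ)) (Real.log y - Real.log z),
    sub_mul 1 (β * z / (β * z + 1)) (Real.log y - Real.log z)]

/-- The two-level contraction. A vertex has `p` children pinned to `1`, `q` children pinned to `0`,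
and free children `i ∈ N` with odds `r i`; if `γ > 1` there are exactly `d` children. When the total
influence of each free child is at most `1 / (1 - κ)`, the influence of its parent on the subtree of
the vertex is at most what the `d`-regular tree at the fixed point gives. -/
theorem edgeInfluence_mul_le {ι : Type*} {β γ lam z : ℝ} {d : ℕ}
    (h : IsAntiferromagnetic β γ lam) (hz : 0 < z) (hfz : treeRec β γ lam d z = z)
    (hκ : d * edgeInfluence β γ z < 1) (N : Finset ι) (r : ι → ℝ) (hr : ∀ i ∈ N, 0 ≤ r i)
    (p q : ℕ) (hle : p + q + N.card ≤ d) (hγ1 : 1 < γ → p + q + N.card = d) :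
    edgeInfluence β γ (lam * β ^ p / γ ^ q * ∏ i ∈ N, oddsFactor β γ (r i)) *
        (1 + (1 - d * edgeInfluence β γ z)⁻¹ * ∑ i ∈ N, edgeInfluence β γ (r i)) ≤
      (1 - d * edgeInfluence β γ z)⁻¹ * edgeInfluence β γ z := by
  obtain ⟨hβ, hβγ, hγ, hlam, hlt⟩ := h
  set κ := d * edgeInfluence β γ z with hκ_def
  set y := lam * β ^ p / γ ^ q * ∏ i ∈ N, oddsFactor β γ (r i) with hy_def
  have h3 : 0 < 1 - β * γ := by linarith
  have hc : 0 < (1 - κ)⁻¹ := inv_pos.2 (by linarith)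
  have hez := edgeInfluence_nonneg hβ hγ hlt hz.le
  have hg : ∀ i ∈ N, 0 < oddsFactor β γ (r i) := fun i hi => oddsFactor_pos hβ hγ (hr i hi)
  have hP : 0 < ∏ i ∈ N, oddsFactor β γ (r i) := Finset.prod_pos hg
  have hsum : 0 ≤ ∑ i ∈ N, edgeInfluence β γ (r i) :=
    Finset.sum_nonneg fun i hi => edgeInfluence_nonneg hβ hγ hlt (hr i hi)
  rcases (pow_nonneg hβ p).eq_or_lt with hp | hp
  · have : y = 0 := by rw [hy_def, ← hp]; simp
    rw [this]
    simp only [edgeInfluence, mul_zero, zero_div, zero_mul]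
    exact mul_nonneg hc.le hez
  have hy : 0 < y := by positivity
  set T : ℝ → ℝ := fun t => edgeInfluence β γ z -
    influenceSlope β γ z * (Real.log t - Real.log (oddsFactor β γ z)) with hT
  have hTr : ∀ i ∈ N, edgeInfluence β γ (r i) ≤ T (oddsFactor β γ (r i)) := fun i hi => by
    rw [edgeInfluence_eq_of_oddsFactor hβ hγ hlt (hr i hi)]
    exact influence_le_tangent hβ hγ hlt hz (hg i hi)
  have hT0 : 0 ≤ T γ⁻¹ := by
    refine le_trans (le_of_eq ?_) (influence_le_tangent hβ hγ hlt hz (inv_pos.2 hγ))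
    field_simp
    ring
  have hT1 : 0 ≤ (p : ℝ) * T β := by
    rcases Nat.eq_zero_or_pos p with rfl | hp0
    · simp
    have hβ0 : 0 < β := hβ.lt_of_ne fun e => by
      rw [← e, zero_pow hp0.ne'] at hp; exact hp.false
    refine mul_nonneg (Nat.cast_nonneg _)
      (le_trans (le_of_eq ?_) (influence_le_tangent hβ hγ hlt hz hβ0))
    field_simp
    ring
  -- a missing child has odds factor `1` and no influence; this occurs only for `γ ≤ 1`
  have hTm : 0 ≤ ((d : ℝ) - p - q - N.card) * T 1 := by
    by_cases hγ' : 1 < γ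
    · have := hγ1 hγ'
      rw [← this]
      push_cast
      apply le_of_eq
      ring
    · have hd : (p : ℝ) + q + N.card ≤ d := by exact_mod_cast hle
      refine mul_nonneg (by linarith)
        (le_trans ?_ (influence_le_tangent hβ hγ hlt hz one_pos))
      refine div_nonneg ?_ h3.le
      nlinarith [mul_nonneg (sub_nonneg.2 (not_lt.1 hγ'))
        (sub_nonneg.2 (hβγ.trans (not_lt.1 hγ')))]
  have hlogz : Real.log z = Real.log lam + d * Real.log (oddsFactor β γ z) := by
    have hgz := oddsFactor_pos hβ hγ hz.le
    conv_lhs => rw [← hfz]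
    rw [treeRec, ← oddsFactor, Real.log_mul hlam.ne' (by positivity), Real.log_pow]
  have hlogy : Real.log y = Real.log lam + p * Real.log β - q * Real.log γ +
      ∑ i ∈ N, Real.log (oddsFactor β γ (r i)) := by
    rw [hy_def, Real.log_mul (by positivity) hP.ne', Real.log_div (by positivity) (by positivity),
      Real.log_mul hlam.ne' hp.ne', Real.log_pow, Real.log_pow,
      Real.log_prod fun i hi => (hg i hi).ne']
  have hsum_le : ∑ i ∈ N, edgeInfluence β γ (r i) ≤
      κ - influenceSlope β γ z * (Real.log y - Real.log z) := by
    have h1 := Finset.sum_le_sum hTr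
    have h2 : ∑ i ∈ N, T (oddsFactor β γ (r i)) = N.card * edgeInfluence β γ z -
        influenceSlope β γ z * (∑ i ∈ N, Real.log (oddsFactor β γ (r i)) -
          N.card * Real.log (oddsFactor β γ z)) := by
      simp only [hT, Finset.sum_sub_distrib, ← Finset.mul_sum, Finset.sum_const, nsmul_eq_mul]
    have h4 := mul_nonneg (Nat.cast_nonneg (α := ℝ) q) hT0
    simp only [hT, Real.log_one, Real.log_inv] at hT1 hTm h4
    rw [hlogy, hlogz, hκ_def]
    linarith
  have hlog1 : Real.log (1 + (1 - κ)⁻¹ * ∑ i ∈ N, edgeInfluence β γ (r i)) ≤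
      Real.log (1 - κ)⁻¹ + (∑ i ∈ N, edgeInfluence β γ (r i) - κ) := by
    have h1 : 0 < 1 - κ := by linarith
    have h2 : 0 < 1 - κ + ∑ i ∈ N, edgeInfluence β γ (r i) := by linarith
    have e : 1 + (1 - κ)⁻¹ * ∑ i ∈ N, edgeInfluence β γ (r i) =
        (1 - κ)⁻¹ * (1 - κ + ∑ i ∈ N, edgeInfluence β γ (r i)) := by
      field_simp
    rw [e, Real.log_mul hc.ne' h2.ne']
    linarith [Real.log_le_sub_one_of_pos h2]
  have hpos : ∀ x : ℝ, 0 < x → 0 < edgeInfluence β γ x := fun x hx => by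
    unfold edgeInfluence; positivity
  have hey := hpos y hy
  have hez' := hpos z hz
  have hl := log_edgeInfluence_le_tangent hβ hγ hlt hz hy
  rw [← Real.log_le_log_iff (by positivity) (by positivity),
    Real.log_mul hey.ne' (by positivity), Real.log_mul hc.ne' hez'.ne']
  linarith

/-! ### Two-spin systems with vertex-dependent fields -/

section Fields

variable {V : Type*} [Fintype V] [DecidableEq V]

/-- The interaction of two adjacent spins: `β` for two spins `1`, `γ` for two spins `0`. -/
noncomputable def pairWeight (β γ : ℝ) (a b : Bool) : ℝ :=
  if a then (if b then β else 1) else (if b then 1 else γ)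

/-- The factor that the edge `e` contributes to the weight of the configuration `σ`. -/
noncomputable def edgeWeight (β γ : ℝ) (σ : V → Bool) (e : Sym2 V) : ℝ :=
  if ∀ v ∈ e, σ v = true then β else if ∀ v ∈ e, σ v = false then γ else 1

theorem edgeWeight_mk (β γ : ℝ) (σ : V → Bool) (a b : V) :
    edgeWeight β γ σ s(a, b) = pairWeight β γ (σ a) (σ b) := by
  unfold edgeWeight pairWeight
  cases ha : σ a <;> cases hb : σ b <;> simp [Sym2.mem_iff, ha, hb]

theorem edgeWeight_nonneg {β γ : ℝ} (hβ : 0 ≤ β) (hγ : 0 < γ) (σ : V → Bool) (e : Sym2 V) :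
    0 ≤ edgeWeight β γ σ e := by
  unfold edgeWeight
  split_ifs <;> positivity

/-- The weight of a configuration in the system with edge set `E` and fields `F`: the vertex `x`
contributes `F x s` when its spin is `s`. -/
noncomputable def fieldWeight (β γ : ℝ) (E : Finset (Sym2 V)) (F : V → Bool → ℝ)
    (σ : V → Bool) : ℝ :=
  (∏ x, F x (σ x)) * ∏ e ∈ E, edgeWeight β γ σ e

/-- The neighbours of `u` in the edge set `E`. -/
def nbrs (E : Finset (Sym2 V)) (u : V) : Finset V := Finset.univ.filter fun x => s(u, x) ∈ E

/-- The edge set obtained from `E` by deleting all edges at `u`. -/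
def deleteEdgesAt (E : Finset (Sym2 V)) (u : V) : Finset (Sym2 V) := E.filter fun e => u ∉ e

theorem mem_nbrs {E : Finset (Sym2 V)} {u x : V} : x ∈ nbrs E u ↔ s(u, x) ∈ E := by
  simp [nbrs]

theorem mem_nbrs_comm {E : Finset (Sym2 V)} {u x : V} : x ∈ nbrs E u ↔ u ∈ nbrs E x := by
  rw [mem_nbrs, mem_nbrs, Sym2.eq_swap]

theorem notMem_nbrs_self {E : Finset (Sym2 V)} (hE : ∀ e ∈ E, ¬ e.IsDiag) (u : V) :
    u ∉ nbrs E u := fun h => hE _ (mem_nbrs.1 h) (Sym2.mk_isDiag_iff.2 rfl)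

theorem nbrs_deleteEdgesAt (E : Finset (Sym2 V)) (u x : V) :
    nbrs (deleteEdgesAt E u) x = if x = u then ∅ else (nbrs E x).erase u := by
  ext y
  by_cases hx : x = u
  · subst hx
    simp [nbrs, deleteEdgesAt]
  · simp only [nbrs, deleteEdgesAt, hx, if_false, Finset.mem_filter, Finset.mem_univ, true_and,
      Finset.mem_erase, Sym2.mem_iff]
    constructor
    · rintro ⟨h1, h2⟩
      exact ⟨fun h => h2 (Or.inr h.symm), h1⟩
    · rintro ⟨h1, h2⟩
      exact ⟨h2, fun h => h.elim (fun h => hx h.symm) fun h => h1 h.symm⟩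

theorem prod_edges_eq {E : Finset (Sym2 V)} (u : V) (f : Sym2 V → ℝ) :
    ∏ e ∈ E, f e = (∏ e ∈ deleteEdgesAt E u, f e) * ∏ x ∈ nbrs E u, f s(u, x) := by
  have h : E.filter (fun e => ¬ u ∉ e) = (nbrs E u).image fun x => s(u, x) := by
    ext e
    simp only [Finset.mem_filter, not_not, Finset.mem_image, mem_nbrs]
    constructor
    · rintro ⟨he, hu⟩
      obtain ⟨y, rfl⟩ := hu
      exact ⟨y, he, rfl⟩
    · rintro ⟨x, hx, rfl⟩
      exact ⟨hx, Sym2.mem_mk_left _ _⟩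
  rw [← Finset.prod_filter_mul_prod_filter_not E (fun e => u ∉ e), h, Finset.prod_image]
  · rfl
  · intro x _ y _ hxy
    exact Sym2.congr_right.1 hxy

/-- The fields after the vertex `u` is replaced, for each `x ∈ N`, by a neighbour of `x` that is
pinned to `1` if `x ∈ K` and to `0` otherwise; the vertex `u` itself is pinned to `b`. -/
noncomputable def splitFields (β γ : ℝ) (F : V → Bool → ℝ) (u : V) (b : Bool) (N K : Finset V) :
    V → Bool → ℝ := fun x s =>
  if x = u then (if s = b then 1 else 0)
  else F x s * if x ∈ K then pairWeight β γ true s else if x ∈ N then pairWeight β γ false s else 1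

/-- Conditioning on the spin of `u` deletes the edges at `u` and changes the fields of its
neighbours. -/
theorem fieldWeight_mul_indicator {β γ : ℝ} {E : Finset (Sym2 V)} (hE : ∀ e ∈ E, ¬ e.IsDiag)
    (F : V → Bool → ℝ) (u : V) (b : Bool) (σ : V → Bool) :
    fieldWeight β γ E F σ * (if σ u = b then 1 else 0) = F u b *
      fieldWeight β γ (deleteEdgesAt E u)
        (splitFields β γ F u b (nbrs E u) (if b then nbrs E u else ∅)) σ := by
  unfold fieldWeight
  rw [← Finset.mul_prod_erase Finset.univ
    (fun x => splitFields β γ F u b (nbrs E u) (if b then nbrs E u else ∅) x (σ x))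
    (Finset.mem_univ u), ← Finset.mul_prod_erase Finset.univ
    (fun x => F x (σ x)) (Finset.mem_univ u), prod_edges_eq u]
  by_cases hb : σ u = b
  · have h1 : ∏ x ∈ Finset.univ.erase u,
        splitFields β γ F u b (nbrs E u) (if b then nbrs E u else ∅) x (σ x) =
        (∏ x ∈ Finset.univ.erase u, F x (σ x)) * ∏ x ∈ nbrs E u, edgeWeight β γ σ s(u, x) := by
      have h2 : nbrs E u ⊆ Finset.univ.erase u := fun x hx =>
        Finset.mem_erase.2 ⟨fun h => notMem_nbrs_self hE u (h ▸ hx), Finset.mem_univ x⟩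
      rw [← Finset.inter_eq_right.2 h2, ← Finset.prod_ite_mem, ← Finset.prod_mul_distrib]
      refine Finset.prod_congr rfl fun x hx => ?_
      have hxu : x ≠ u := (Finset.mem_erase.1 hx).1
      rw [edgeWeight_mk, hb]
      by_cases hxN : x ∈ nbrs E u <;> cases b <;> simp [splitFields, hxu, hxN]
    rw [h1]
    simp only [hb, splitFields, if_true]
    ring
  · simp [hb, splitFields]

/-- The fields at a vertex without edges do not influence the other spins. -/
theorem sum_fieldWeight_splitFields {β γ : ℝ} {E : Finset (Sym2 V)} (F : V → Bool → ℝ) (u : V)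
    (b : Bool) (N K : Finset V) {f : (V → Bool) → ℝ}
    (hf : ∀ σ s, f (Function.update σ u s) = f σ) :
    ∑ σ, fieldWeight β γ (deleteEdgesAt E u) (splitFields β γ F u b N K) σ * f σ =
      ∑ σ, fieldWeight β γ (deleteEdgesAt E u) (splitFields β γ F u false N K) σ * f σ := by
  cases b
  · rfl
  have hinv : Function.Involutive fun σ : V → Bool => Function.update σ u (!σ u) := fun σ => by
    simp
  refine Fintype.sum_equiv (hinv.toPerm _) _ _ fun σ => ?_
  simp only [Function.Involutive.coe_toPerm, hf]
  congr 1
  unfold fieldWeight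
  congr 1
  · refine Finset.prod_congr rfl fun x _ => ?_
    by_cases hx : x = u
    · subst hx
      simp [splitFields]
    · simp [splitFields, hx]
  · refine Finset.prod_congr rfl fun e he => ?_
    have hu : u ∉ e := (Finset.mem_filter.1 he).2
    induction e with
    | _ a b =>
      simp only [Sym2.mem_iff, not_or] at hu
      rw [edgeWeight_mk, edgeWeight_mk, Function.update_of_ne (Ne.symm hu.1),
        Function.update_of_ne (Ne.symm hu.2)]

/-! ### Influences in systems with fields -/

/-- The total weight of the configurations with spin `b` at `u`. -/
noncomputable def spinSum (β γ : ℝ) (E : Finset (Sym2 V)) (F : V → Bool → ℝ) (u : V) (b : Bool) :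
    ℝ := ∑ σ, fieldWeight β γ E F σ * if σ u = b then 1 else 0

/-- The total weight of the configurations with spin `b` at `u` and spin `1` at `v`. -/
noncomputable def pairSum (β γ : ℝ) (E : Finset (Sym2 V)) (F : V → Bool → ℝ) (u : V) (b : Bool)
    (v : V) : ℝ :=
  ∑ σ, fieldWeight β γ E F σ * ((if σ u = b then 1 else 0) * if σ v = true then 1 else 0)

/-- The probability of spin `1` at `v`. -/
noncomputable def marginal (β γ : ℝ) (E : Finset (Sym2 V)) (F : V → Bool → ℝ) (v : V) : ℝ :=
  spinSum β γ E F v true / ∑ σ, fieldWeight β γ E F σ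

/-- The odds of spin `1` at `u`. -/
noncomputable def odds (β γ : ℝ) (E : Finset (Sym2 V)) (F : V → Bool → ℝ) (u : V) : ℝ :=
  spinSum β γ E F u true / spinSum β γ E F u false

/-- The change of the probability of spin `1` at `v` when the spin of `u` changes from `0` to `1`.
For `v = u` this is `1` (provided that both spins of `u` are possible). -/
noncomputable def influence (β γ : ℝ) (E : Finset (Sym2 V)) (F : V → Bool → ℝ) (u v : V) : ℝ :=
  pairSum β γ E F u true v / spinSum β γ E F u true -
    pairSum β γ E F u false v / spinSum β γ E F u false

theorem spinSum_eq_splitFields {β γ : ℝ} {E : Finset (Sym2 V)} (hE : ∀ e ∈ E, ¬ e.IsDiag)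
    (F : V → Bool → ℝ) (u : V) (b : Bool) : spinSum β γ E F u b = F u b *
      ∑ σ, fieldWeight β γ (deleteEdgesAt E u)
        (splitFields β γ F u false (nbrs E u) (if b then nbrs E u else ∅)) σ := by
  have h := sum_fieldWeight_splitFields (β := β) (γ := γ) (E := E) F u b (nbrs E u)
    (if b then nbrs E u else ∅) (f := fun _ => 1) fun _ _ => rfl
  simp only [mul_one] at h
  rw [spinSum, ← h, Finset.mul_sum]
  exact Finset.sum_congr rfl fun σ _ => fieldWeight_mul_indicator hE F u b σ

theorem pairSum_eq_splitFields {β γ : ℝ} {E : Finset (Sym2 V)} (hE : ∀ e ∈ E, ¬ e.IsDiag)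
    (F : V → Bool → ℝ) {u v : V} (huv : u ≠ v) (b : Bool) : pairSum β γ E F u b v = F u b *
      spinSum β γ (deleteEdgesAt E u)
        (splitFields β γ F u false (nbrs E u) (if b then nbrs E u else ∅)) v true := by
  have h := sum_fieldWeight_splitFields (β := β) (γ := γ) (E := E) F u b (nbrs E u)
    (if b then nbrs E u else ∅) (f := fun σ => if σ v = true then 1 else 0)
    fun σ s => by simp [Function.update_of_ne huv.symm]
  rw [pairSum, spinSum, ← h, Finset.mul_sum]
  refine Finset.sum_congr rfl fun σ _ => ?_
  rw [← mul_assoc, ← mul_assoc, fieldWeight_mul_indicator hE F u b σ]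

theorem influence_eq_marginal_sub {β γ : ℝ} {E : Finset (Sym2 V)} (hE : ∀ e ∈ E, ¬ e.IsDiag)
    {F : V → Bool → ℝ} {u v : V} (huv : u ≠ v) (hF : ∀ b, F u b ≠ 0) :
    influence β γ E F u v =
      marginal β γ (deleteEdgesAt E u) (splitFields β γ F u false (nbrs E u) (nbrs E u)) v -
      marginal β γ (deleteEdgesAt E u) (splitFields β γ F u false (nbrs E u) ∅) v := by
  rw [influence, pairSum_eq_splitFields hE F huv, pairSum_eq_splitFields hE F huv,
    spinSum_eq_splitFields hE, spinSum_eq_splitFields hE, mul_div_mul_left _ _ (hF _),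
    mul_div_mul_left _ _ (hF _)]
  rfl

theorem odds_eq_splitFields {β γ : ℝ} {E : Finset (Sym2 V)} (hE : ∀ e ∈ E, ¬ e.IsDiag)
    (F : V → Bool → ℝ) (u : V) : odds β γ E F u = F u true / F u false *
      ((∑ σ, fieldWeight β γ (deleteEdgesAt E u)
          (splitFields β γ F u false (nbrs E u) (nbrs E u)) σ) /
        ∑ σ, fieldWeight β γ (deleteEdgesAt E u)
          (splitFields β γ F u false (nbrs E u) ∅) σ) := by
  rw [odds, spinSum_eq_splitFields hE, spinSum_eq_splitFields hE, mul_div_mul_comm]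
  rfl

theorem fieldWeight_nonneg {β γ : ℝ} (hβ : 0 ≤ β) (hγ : 0 < γ) (E : Finset (Sym2 V))
    {F : V → Bool → ℝ} (hF : ∀ x s, 0 ≤ F x s) (σ : V → Bool) : 0 ≤ fieldWeight β γ E F σ :=
  mul_nonneg (Finset.prod_nonneg fun x _ => hF x _)
    (Finset.prod_nonneg fun e _ => edgeWeight_nonneg hβ hγ σ e)

/-- A configuration that is `0` at all endpoints of edges has positive weight if the fields allow
it. -/
theorem fieldWeight_pos {β γ : ℝ} (hγ : 0 < γ) {E : Finset (Sym2 V)} {F : V → Bool → ℝ}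
    {σ : V → Bool} (hF : ∀ x, 0 < F x (σ x)) (hσ : ∀ x, σ x = true → nbrs E x = ∅) :
    0 < fieldWeight β γ E F σ := by
  refine mul_pos (Finset.prod_pos fun x _ => hF x) (Finset.prod_pos fun e he => ?_)
  induction e with
  | _ a b =>
    have h : ∀ x y, s(x, y) ∈ E → σ x = false := fun x y hxy => by
      by_contra hx
      have := hσ x (by simpa using hx)
      exact Finset.notMem_empty y (this ▸ mem_nbrs.2 hxy)
    rw [edgeWeight_mk, h a b he, h b a (Sym2.eq_swap ▸ he)]
    simpa [pairWeight] using hγ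

theorem fieldWeight_update_mul (β γ : ℝ) (E : Finset (Sym2 V)) (F : V → Bool → ℝ) (x : V)
    (φ : Bool → ℝ) (σ : V → Bool) :
    fieldWeight β γ E (Function.update F x fun s => F x s * φ s) σ =
      φ (σ x) * fieldWeight β γ E F σ := by
  unfold fieldWeight
  rw [← Finset.mul_prod_erase Finset.univ _ (Finset.mem_univ x),
    ← Finset.mul_prod_erase Finset.univ (fun x => F x (σ x)) (Finset.mem_univ x),
    Finset.prod_congr rfl fun y hy => by
      rw [Function.update_of_ne (Finset.mem_erase.1 hy).1]]
  simp only [Function.update_self]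
  ring

theorem sum_fieldWeight_update_mul (β γ : ℝ) (E : Finset (Sym2 V)) (F : V → Bool → ℝ) (x : V)
    (φ : Bool → ℝ) :
    ∑ σ, fieldWeight β γ E (Function.update F x fun s => F x s * φ s) σ =
      φ true * spinSum β γ E F x true + φ false * spinSum β γ E F x false := by
  simp only [spinSum, Finset.mul_sum, ← Finset.sum_add_distrib, fieldWeight_update_mul]
  refine Finset.sum_congr rfl fun σ _ => ?_
  cases σ x <;> simp

theorem spinSum_update_mul (β γ : ℝ) (E : Finset (Sym2 V)) (F : V → Bool → ℝ) (x : V)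
    (φ : Bool → ℝ) (v : V) :
    spinSum β γ E (Function.update F x fun s => F x s * φ s) v true =
      φ true * pairSum β γ E F x true v + φ false * pairSum β γ E F x false v := by
  simp only [spinSum, pairSum, Finset.mul_sum, ← Finset.sum_add_distrib, fieldWeight_update_mul]
  refine Finset.sum_congr rfl fun σ _ => ?_
  cases σ x <;> simp

/-- Attaching to `x` a neighbour pinned to `1` instead of one pinned to `0` multiplies the partition
function by the odds factor of `x` and moves the marginals along the influences of `x`. -/
theorem ratio_and_marginal_sub_of_pinned_neighbour {β γ : ℝ} (hβ : 0 ≤ β) (hγ : 0 < γ)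
    {E : Finset (Sym2 V)} {F : V → Bool → ℝ} (hF : ∀ x s, 0 ≤ F x s) {x : V}
    (h0 : 0 < spinSum β γ E F x false) :
    (∑ σ, fieldWeight β γ E
        (Function.update F x fun s => F x s * pairWeight β γ true s) σ) =
      oddsFactor β γ (odds β γ E F x) * ∑ σ, fieldWeight β γ E
        (Function.update F x fun s => F x s * pairWeight β γ false s) σ ∧
    ∀ v, marginal β γ E (Function.update F x fun s => F x s * pairWeight β γ true s) v -
      marginal β γ E (Function.update F x fun s => F x s * pairWeight β γ false s) v =
      -(edgeInfluence β γ (odds β γ E F x) * influence β γ E F x v) := by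
  have hw := fieldWeight_nonneg hβ hγ E hF
  have h1 : 0 ≤ spinSum β γ E F x true := Finset.sum_nonneg fun σ _ =>
    mul_nonneg (hw σ) (by split_ifs <;> norm_num)
  constructor
  · rw [sum_fieldWeight_update_mul, sum_fieldWeight_update_mul]
    simp only [pairWeight, odds, oddsFactor]
    generalize spinSum β γ E F x true = a at *
    generalize spinSum β γ E F x false = b at *
    have : a + b * γ ≠ 0 := by positivity
    simp
    field_simp
  · intro v
    unfold marginal
    rw [sum_fieldWeight_update_mul, sum_fieldWeight_update_mul, spinSum_update_mul,
      spinSum_update_mul]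
    have h2 : spinSum β γ E F x true = 0 → pairSum β γ E F x true v = 0 := fun h => by
      have h3 := (Finset.sum_eq_zero_iff_of_nonneg fun σ _ =>
        mul_nonneg (hw σ) (by split_ifs <;> norm_num)).1 h
      refine Finset.sum_eq_zero fun σ hσ => ?_
      rw [← mul_assoc, h3 σ hσ, zero_mul]
    simp only [pairWeight, odds, influence, edgeInfluence]
    generalize spinSum β γ E F x true = a at *
    generalize spinSum β γ E F x false = b at *
    generalize pairSum β γ E F x true v = a' at *
    generalize pairSum β γ E F x false v = b' at *
    have e1 : β * a + b ≠ 0 := by positivity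
    have e2 : a + γ * b ≠ 0 := by positivity
    have e3 : a + b * γ ≠ 0 := by positivity
    rcases h1.eq_or_lt with rfl | ha
    · rw [h2 rfl]
      simp
      field_simp
      ring
    · simp
      field_simp
      ring

end Fields

section Recursion

variable {V : Type*} [Fintype V] [DecidableEq V]

/-! ### The recursion over self-avoiding walks -/

/-- The field at `x` is that of a vertex of activity `lam` with `p` neighbours pinned to `1` and `q`
neighbours pinned to `0`, and together with its remaining neighbours in `E` it has at most `D`
neighbours, and exactly `D` if `γ > 1`. -/
def HasDegree (β γ lam : ℝ) (E : Finset (Sym2 V)) (F : V → Bool → ℝ) (D : ℕ) (x : V) : Prop :=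
  ∃ p q : ℕ, F x true = lam * β ^ p ∧ F x false = γ ^ q ∧ p + q + (nbrs E x).card ≤ D ∧
    (1 < γ → p + q + (nbrs E x).card = D)

/-- Replacing a vertex `u` by pinned copies does not change the degrees of the other vertices. -/
theorem HasDegree.splitFields {β γ lam : ℝ} {E : Finset (Sym2 V)} {F : V → Bool → ℝ} {D : ℕ}
    {u y : V} (hyu : y ≠ u) (h : HasDegree β γ lam E F D y) (b : Bool) {K : Finset V}
    (hK : K ⊆ nbrs E u) :
    HasDegree β γ lam (deleteEdgesAt E u) (splitFields β γ F u b (nbrs E u) K) D y := by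
  obtain ⟨p, q, h1, h2, h3, h4⟩ := h
  have hnb : nbrs (deleteEdgesAt E u) y = (nbrs E y).erase u := by
    rw [nbrs_deleteEdgesAt, if_neg hyu]
  unfold HasDegree
  rw [hnb]
  by_cases hyN : y ∈ nbrs E u
  · have hc := Finset.card_erase_add_one (mem_nbrs_comm.1 hyN)
    by_cases hyK : y ∈ K
    · refine ⟨p + 1, q, ?_, ?_, by omega, fun hg => by have := h4 hg; omega⟩
      · simp [TwoSpin.splitFields, hyu, hyK, pairWeight, h1, pow_succ, mul_assoc]
      · simp [TwoSpin.splitFields, hyu, hyK, pairWeight, h2]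
    · refine ⟨p, q + 1, ?_, ?_, by omega, fun hg => by have := h4 hg; omega⟩
      · simp [TwoSpin.splitFields, hyu, hyK, hyN, pairWeight, h1]
      · simp [TwoSpin.splitFields, hyu, hyK, hyN, pairWeight, h2, pow_succ]
  · have hyK : y ∉ K := fun hy => hyN (hK hy)
    rw [Finset.erase_eq_of_notMem fun h => hyN (mem_nbrs_comm.1 h)]
    exact ⟨p, q, by simp [TwoSpin.splitFields, hyu, hyK, hyN, h1],
      by simp [TwoSpin.splitFields, hyu, hyK, hyN, h2], h3, h4⟩

theorem splitFields_nonneg {V : Type*} [DecidableEq V] {β γ : ℝ} (hβ : 0 ≤ β) (hγ : 0 < γ)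
    {F : V → Bool → ℝ} (hF : ∀ x s, 0 ≤ F x s) (u : V) (b : Bool) (N K : Finset V) (y : V) (s : Bool) :
    0 ≤ splitFields β γ F u b N K y s := by
  have hpw : ∀ b s, 0 ≤ pairWeight β γ b s := by
    intro b s
    cases b <;> cases s <;> simp [pairWeight, hβ, hγ.le]
  unfold splitFields
  split_ifs <;> norm_num
  · exact mul_nonneg (hF y s) (hpw _ _)
  · exact mul_nonneg (hF y s) (hpw _ _)
  · exact hF y s

/-- The systems met when the neighbourhood of `u` is explored along self-avoiding walks: every other
vertex that still has an edge looks like a vertex of a graph of maximum degree `d + 1`. -/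
structure IsContext (β γ lam : ℝ) (d : ℕ) (E : Finset (Sym2 V)) (F : V → Bool → ℝ) (u : V) :
    Prop where
  loopless : ∀ e ∈ E, ¬ e.IsDiag
  nonneg : ∀ x s, 0 ≤ F x s
  exists_pos : ∀ x, ∃ s, 0 < F x s ∧ (s = true → nbrs E x = ∅)
  hasDegree : ∀ x, x ≠ u → (nbrs E x).Nonempty → HasDegree β γ lam E F (d + 1) x

theorem IsContext.fieldWeight_pos {β γ lam : ℝ} {d : ℕ} {E : Finset (Sym2 V)}
    {F : V → Bool → ℝ} {u : V} (h : IsContext β γ lam d E F u) (hβ : 0 ≤ β) (hγ : 0 < γ) :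
    0 < ∑ σ, fieldWeight β γ E F σ := by
  choose ρ h1 h2 using h.exists_pos
  exact Finset.sum_pos' (fun σ _ => fieldWeight_nonneg hβ hγ E h.nonneg σ)
    ⟨ρ, Finset.mem_univ _, TwoSpin.fieldWeight_pos hγ h1 h2⟩

theorem IsContext.spinSum_false_pos {β γ lam : ℝ} {d : ℕ} {E : Finset (Sym2 V)}
    {F : V → Bool → ℝ} {u : V} (h : IsContext β γ lam d E F u) (hβ : 0 ≤ β) (hγ : 0 < γ) {x : V}
    (hx : 0 < F x false) : 0 < spinSum β γ E F x false := by
  choose ρ h1 h2 using h.exists_pos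
  have hw := fieldWeight_nonneg hβ hγ E h.nonneg
  refine Finset.sum_pos' (fun σ _ => mul_nonneg (hw σ) (by split_ifs <;> norm_num))
    ⟨Function.update ρ x false, Finset.mem_univ _, ?_⟩
  rw [Function.update_self, if_pos rfl, mul_one]
  refine TwoSpin.fieldWeight_pos hγ (fun y => ?_) fun y => ?_ <;> by_cases hy : y = x
  · subst hy; simpa using hx
  · simpa [hy] using h1 y
  · subst hy; simp
  · simpa [hy] using h2 y

/-- Splitting `u` into pinned copies attached to its neighbours, except the copy at `x`, yields a
context for `x`. -/
theorem IsContext.child {β γ lam : ℝ} {d : ℕ} {E : Finset (Sym2 V)} {F : V → Bool → ℝ} {u : V}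
    (h : IsContext β γ lam d E F u) (hβ : 0 ≤ β) (hγ : 0 < γ) {x : V} (hx : x ∈ nbrs E u)
    {K : Finset V} (hK : K ⊆ nbrs E u) :
    IsContext β γ lam d (deleteEdgesAt E u)
      (Function.update (splitFields β γ F u false (nbrs E u) K) x (F x)) x ∧
    HasDegree β γ lam (deleteEdgesAt E u)
      (Function.update (splitFields β γ F u false (nbrs E u) K) x (F x)) d x := by
  have hne : ∀ y ∈ nbrs E u, y ≠ u := fun y hy e => notMem_nbrs_self h.loopless u (e ▸ hy)
  have hnb : ∀ y, y ≠ u → nbrs (deleteEdgesAt E u) y = (nbrs E y).erase u := fun y hy => by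
    rw [nbrs_deleteEdgesAt, if_neg hy]
  have hcard : ∀ y ∈ nbrs E u, (nbrs (deleteEdgesAt E u) y).card + 1 = (nbrs E y).card :=
    fun y hy => by rw [hnb y (hne y hy), Finset.card_erase_add_one (mem_nbrs_comm.1 hy)]
  have hF0 : ∀ y ∈ nbrs E u, 0 < F y false := fun y hy => by
    obtain ⟨s, h1, h2⟩ := h.exists_pos y
    cases s
    · exact h1
    · have := h2 rfl ▸ mem_nbrs_comm.1 hy
      exact absurd this (Finset.notMem_empty _)
  refine ⟨⟨fun e he => h.loopless e (Finset.mem_filter.1 he).1, ?_, ?_, ?_⟩, ?_⟩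
  · intro y s
    by_cases hyx : y = x
    · subst hyx; simpa using h.nonneg y s
    · rw [Function.update_of_ne hyx]
      exact splitFields_nonneg hβ hγ h.nonneg _ _ _ _ _ _
  · intro y
    by_cases hyx : y = x
    · subst hyx
      exact ⟨false, by simpa using hF0 y hx, by simp⟩
    · rw [Function.update_of_ne hyx]
      by_cases hyu : y = u
      · exact ⟨false, by simp [splitFields, hyu], by simp⟩
      · by_cases hyN : y ∈ nbrs E u
        · refine ⟨false, ?_, by simp⟩
          have := hF0 y hyN
          by_cases hyK : y ∈ K <;> simp [splitFields, hyu, hyN, hyK, pairWeight] <;> positivity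
        · obtain ⟨s, h1, h2⟩ := h.exists_pos y
          refine ⟨s, ?_, fun hs => ?_⟩
          · have hyK : y ∉ K := fun hy => hyN (hK hy)
            simpa [splitFields, hyu, hyN, hyK] using h1
          · rw [hnb y hyu, h2 hs, Finset.erase_empty]
  · intro y hyx hy
    have hyu : y ≠ u := by
      rintro rfl
      rw [nbrs_deleteEdgesAt, if_pos rfl] at hy
      exact Finset.not_nonempty_empty hy
    have hy' : (nbrs E y).Nonempty := by
      rw [hnb y hyu] at hy
      exact hy.mono (Finset.erase_subset _ _)
    have := (h.hasDegree y hyu hy').splitFields hyu false hK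
    unfold HasDegree at this ⊢
    rwa [Function.update_of_ne hyx]
  · obtain ⟨p, q, h1, h2, h3, h4⟩ := h.hasDegree x (hne x hx) ⟨u, mem_nbrs_comm.1 hx⟩
    have hc := hcard x hx
    exact ⟨p, q, by simpa using h1, by simpa using h2, by omega, fun hg => by
      have := h4 hg; omega⟩

/-- The bounds satisfied by the root `u` of a context: its total influence is at most `c`, and the
influence of a parent attached to `u` on the whole context is at most `b`. -/
def InfluenceBound (β γ : ℝ) (E : Finset (Sym2 V)) (F : V → Bool → ℝ) (b c : ℝ) (u : V) : Prop :=
  ∑ v, |influence β γ E F u v| ≤ c ∧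
    edgeInfluence β γ (odds β γ E F u) * ∑ v, |influence β γ E F u v| ≤ b

/-- Switching the pinned copies of `u` from `0` to `1` one neighbour at a time: the partition
functions and marginals before and after are compared through the odds of the children. -/
theorem exists_child_odds {β γ lam b c : ℝ} {d : ℕ} {E : Finset (Sym2 V)} {F : V → Bool → ℝ}
    {u : V} (h : IsContext β γ lam d E F u) (hβ : 0 ≤ β) (hγ : 0 < γ) (hlt : β * γ < 1)
    (hb : 0 ≤ b)
    (IH : ∀ (F' : V → Bool → ℝ) (x : V), x ∈ nbrs E u →
      IsContext β γ lam d (deleteEdgesAt E u) F' x →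
      HasDegree β γ lam (deleteEdgesAt E u) F' d x → 0 < F' x true →
      InfluenceBound β γ (deleteEdgesAt E u) F' b c x)
    (K : Finset V) (hK : K ⊆ nbrs E u) :
    ∃ r : V → ℝ, (∀ x, 0 ≤ r x) ∧
      (∑ σ, fieldWeight β γ (deleteEdgesAt E u) (splitFields β γ F u false (nbrs E u) K) σ) =
        (∏ x ∈ K, oddsFactor β γ (r x)) * ∑ σ, fieldWeight β γ (deleteEdgesAt E u)
          (splitFields β γ F u false (nbrs E u) ∅) σ ∧
      (∑ v, |marginal β γ (deleteEdgesAt E u) (splitFields β γ F u false (nbrs E u) K) v -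
        marginal β γ (deleteEdgesAt E u) (splitFields β γ F u false (nbrs E u) ∅) v|) ≤
        c * ∑ x ∈ K, edgeInfluence β γ (r x) ∧
      (∑ v, |marginal β γ (deleteEdgesAt E u) (splitFields β γ F u false (nbrs E u) K) v -
        marginal β γ (deleteEdgesAt E u) (splitFields β γ F u false (nbrs E u) ∅) v|) ≤
        K.card * b := by
  induction K using Finset.induction_on with
  | empty => exact ⟨fun _ => 0, fun _ => le_rfl, by simp, by simp, by simp⟩
  | insert x K hxK ih =>
    obtain ⟨r, hr, hmass, hsum, hsum'⟩ := ih ((Finset.subset_insert x K).trans hK)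
    have hx : x ∈ nbrs E u := hK (Finset.mem_insert_self x K)
    have hxu : x ≠ u := fun e => notMem_nbrs_self h.loopless u (e ▸ hx)
    obtain ⟨hctx, hdeg⟩ := h.child hβ hγ hx ((Finset.subset_insert x K).trans hK)
    -- the system in which `x` has lost its edge to `u`
    set F' := Function.update (splitFields β γ F u false (nbrs E u) K) x (F x) with hF'
    set ρ := odds β γ (deleteEdgesAt E u) F' x with hρ
    have hF'x : F' x = F x := by rw [hF', Function.update_self]
    have hx0 : 0 < F' x false := by
      obtain ⟨p, q, -, h2, -⟩ := hdeg
      rw [h2]; positivity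
    have h0 := hctx.spinSum_false_pos hβ hγ hx0
    have e1 : splitFields β γ F u false (nbrs E u) (insert x K) =
        Function.update F' x fun s => F' x s * pairWeight β γ true s := by
      funext y s
      by_cases hy : y = x
      · subst hy
        simp [splitFields, hxu, hF'x]
      · rw [Function.update_of_ne hy, hF', Function.update_of_ne hy]
        simp [splitFields, hy]
    have e0 : splitFields β γ F u false (nbrs E u) K =
        Function.update F' x fun s => F' x s * pairWeight β γ false s := by
      funext y s
      by_cases hy : y = x
      · subst hy
        simp [splitFields, hxu, hxK, hx, hF'x]
      · rw [Function.update_of_ne hy, hF', Function.update_of_ne hy]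
    obtain ⟨hm, hmarg⟩ := ratio_and_marginal_sub_of_pinned_neighbour hβ hγ hctx.nonneg h0
    rw [← e1, ← e0] at hm
    simp only [← e1, ← e0] at hmarg
    have hρ0 : 0 ≤ ρ := div_nonneg (Finset.sum_nonneg fun σ _ =>
      mul_nonneg (fieldWeight_nonneg hβ hγ _ hctx.nonneg σ) (by split_ifs <;> norm_num)) h0.le
    have hρi := edgeInfluence_nonneg hβ hγ hlt hρ0
    have hstep : edgeInfluence β γ ρ * ∑ v, |influence β γ (deleteEdgesAt E u) F' x v| ≤
          c * edgeInfluence β γ ρ ∧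
        edgeInfluence β γ ρ * ∑ v, |influence β γ (deleteEdgesAt E u) F' x v| ≤ b := by
      rcases (hctx.nonneg x true).eq_or_lt with hz | hz
      · -- spin `1` is impossible at `x`, which then transmits no influence
        have : ρ = 0 := by
          rw [hρ, odds_eq_splitFields hctx.loopless, ← hz]; simp
        simp [this, edgeInfluence, hb]
      · obtain ⟨hc1, hb1⟩ := IH F' x hx hctx hdeg hz
        exact ⟨by rw [mul_comm c]; exact mul_le_mul_of_nonneg_left hc1 hρi, hb1⟩
    have htri : (∑ v, |marginal β γ (deleteEdgesAt E u)
          (splitFields β γ F u false (nbrs E u) (insert x K)) v -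
        marginal β γ (deleteEdgesAt E u) (splitFields β γ F u false (nbrs E u) ∅) v|) ≤
        edgeInfluence β γ ρ * (∑ v, |influence β γ (deleteEdgesAt E u) F' x v|) +
        ∑ v, |marginal β γ (deleteEdgesAt E u) (splitFields β γ F u false (nbrs E u) K) v -
          marginal β γ (deleteEdgesAt E u) (splitFields β γ F u false (nbrs E u) ∅) v| := by
      rw [Finset.mul_sum, ← Finset.sum_add_distrib]
      refine Finset.sum_le_sum fun v _ => (abs_sub_le _ (marginal β γ (deleteEdgesAt E u)
        (splitFields β γ F u false (nbrs E u) K) v) _).trans (le_of_eq ?_)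
      rw [hmarg v, abs_neg, abs_mul, abs_of_nonneg hρi]
    have hK' : ∀ y ∈ K, Function.update r x ρ y = r y := fun y hy =>
      Function.update_of_ne (by rintro rfl; exact hxK hy) _ _
    have hprod : ∏ y ∈ K, oddsFactor β γ (Function.update r x ρ y) =
        ∏ y ∈ K, oddsFactor β γ (r y) :=
      Finset.prod_congr rfl fun y hy => by rw [hK' y hy]
    have hsumr : ∑ y ∈ K, edgeInfluence β γ (Function.update r x ρ y) =
        ∑ y ∈ K, edgeInfluence β γ (r y) :=
      Finset.sum_congr rfl fun y hy => by rw [hK' y hy]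
    refine ⟨Function.update r x ρ, fun y => ?_, ?_, ?_, ?_⟩
    · by_cases hy : y = x
      · subst hy; simpa using hρ0
      · simpa [hy] using hr y
    · rw [Finset.prod_insert hxK, Function.update_self, hm, hmass, hprod, mul_assoc]
    · rw [Finset.sum_insert hxK, Function.update_self, hsumr]
      linarith [hstep.1]
    · rw [Finset.card_insert_of_notMem hxK]
      push_cast
      linarith [hstep.2]

theorem sum_abs_influence_le {β γ : ℝ} {E : Finset (Sym2 V)} (hE : ∀ e ∈ E, ¬ e.IsDiag)
    {F : V → Bool → ℝ} {u : V} (hF : ∀ b, F u b ≠ 0) :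
    ∑ v ∈ Finset.univ.erase u, |influence β γ E F u v| ≤
      ∑ v, |marginal β γ (deleteEdgesAt E u) (splitFields β γ F u false (nbrs E u) (nbrs E u)) v -
        marginal β γ (deleteEdgesAt E u) (splitFields β γ F u false (nbrs E u) ∅) v| := by
  rw [Finset.sum_congr rfl fun v hv => by
    rw [influence_eq_marginal_sub hE (Finset.mem_erase.1 hv).1.symm hF]]
  exact Finset.sum_le_sum_of_subset_of_nonneg (Finset.erase_subset _ _) fun v _ _ => abs_nonneg _

theorem abs_influence_self_le {β γ : ℝ} (E : Finset (Sym2 V)) (F : V → Bool → ℝ) (u : V) :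
    |influence β γ E F u u| ≤ 1 := by
  have h1 : pairSum β γ E F u true u = spinSum β γ E F u true := by
    refine Finset.sum_congr rfl fun σ _ => ?_
    cases σ u <;> simp
  have h0 : pairSum β γ E F u false u = 0 := by
    refine Finset.sum_eq_zero fun σ _ => ?_
    cases σ u <;> simp
  rw [influence, h1, h0, zero_div, sub_zero]
  rcases eq_or_ne (spinSum β γ E F u true) 0 with h | h
  · simp [h]
  · simp [div_self h]

/-- Inside a context the bounds of the `d`-regular tree at the fixed point `z` hold. -/
theorem influenceBound {β γ lam z : ℝ} {d : ℕ} (hp : IsAntiferromagnetic β γ lam) (hz : 0 < z)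
    (hfz : treeRec β γ lam d z = z) (hκ : d * edgeInfluence β γ z < 1) (n : ℕ) :
    ∀ (E : Finset (Sym2 V)) (F : V → Bool → ℝ) (u : V), E.card < n → IsContext β γ lam d E F u →
      HasDegree β γ lam E F d u → 0 < F u true →
      InfluenceBound β γ E F ((1 - d * edgeInfluence β γ z)⁻¹ * edgeInfluence β γ z)
        (1 - d * edgeInfluence β γ z)⁻¹ u := by
  have hβ := hp.beta_nonneg
  have hγ := hp.gamma_pos
  have hlt := hp.mul_lt_one
  have hc : 0 < (1 - d * edgeInfluence β γ z)⁻¹ := inv_pos.2 (by linarith)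
  have hb := mul_nonneg hc.le (edgeInfluence_nonneg hβ hγ hlt hz.le)
  induction n with
  | zero => intro E F u h; omega
  | succ n ih =>
    intro E F u hn hctx hdeg hF1
    obtain ⟨p, q, h1, h2, h3, h4⟩ := hdeg
    have hF0 : 0 < F u false := by rw [h2]; positivity
    have hF : ∀ b, F u b ≠ 0 := fun b => by cases b <;> [exact hF0.ne'; exact hF1.ne']
    obtain ⟨r, hr, hmass, hs1, hs2⟩ := exists_child_odds hctx hβ hγ hlt hb
      (fun F' x hx hc' hd' hF' => ih _ F' x (by
        have : (deleteEdgesAt E u).card < E.card :=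
          Finset.card_lt_card (Finset.filter_ssubset.2
            ⟨_, mem_nbrs.1 hx, by simp⟩)
        omega) hc' hd' hF') (nbrs E u) subset_rfl
    have htot : ∑ v, |influence β γ E F u v| ≤ 1 + ∑ v ∈ Finset.univ.erase u,
        |influence β γ E F u v| := by
      rw [← Finset.add_sum_erase _ _ (Finset.mem_univ u)]
      linarith [abs_influence_self_le (β := β) (γ := γ) E F u]
    have hle := sum_abs_influence_le (β := β) (γ := γ) hctx.loopless hF
    have hmass0 : 0 < ∑ σ, fieldWeight β γ (deleteEdgesAt E u)
        (splitFields β γ F u false (nbrs E u) ∅) σ := by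
      have := hctx.spinSum_false_pos hβ hγ hF0
      rw [spinSum_eq_splitFields hctx.loopless] at this
      exact pos_of_mul_pos_right this hF0.le
    have hodds : odds β γ E F u = lam * β ^ p / γ ^ q * ∏ x ∈ nbrs E u, oddsFactor β γ (r x) := by
      rw [odds_eq_splitFields hctx.loopless, hmass, mul_div_cancel_right₀ _ hmass0.ne', h1, h2]
    refine ⟨?_, ?_⟩
    · have hcard : ((nbrs E u).card : ℝ) ≤ d := by
        have : (nbrs E u).card ≤ d := by omega
        exact_mod_cast this
      have h5 := mul_le_mul_of_nonneg_right hcard hb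
      have h6 : 1 + d * ((1 - d * edgeInfluence β γ z)⁻¹ * edgeInfluence β γ z) =
          (1 - d * edgeInfluence β γ z)⁻¹ := by
        have : 1 - d * edgeInfluence β γ z ≠ 0 := by linarith
        field_simp
        ring
      linarith
    · have hρ : 0 ≤ odds β γ E F u := by
        rw [hodds]
        exact mul_nonneg (h1 ▸ by have := hp.lam_pos; positivity)
          (Finset.prod_nonneg fun x _ => (oddsFactor_pos hβ hγ (hr x)).le)
      refine le_trans (mul_le_mul_of_nonneg_left (htot.trans ?_)
        (edgeInfluence_nonneg hβ hγ hlt hρ)) (hodds ▸ edgeInfluence_mul_le hp hz hfz hκ (nbrs E u) r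
          (fun x _ => hr x) p q h3 h4)
      linarith

/-- The total influence of a vertex of degree at most `d + 1`. -/
theorem sum_influence_le_of_isContext {β γ lam z : ℝ} {d : ℕ} (hp : IsAntiferromagnetic β γ lam)
    (hz : 0 < z) (hfz : treeRec β γ lam d z = z) (hκ : d * edgeInfluence β γ z < 1)
    {E : Finset (Sym2 V)} {F : V → Bool → ℝ} {u : V} (hctx : IsContext β γ lam d E F u)
    (hdeg : HasDegree β γ lam E F (d + 1) u) (hF1 : 0 < F u true) :
    ∑ v ∈ Finset.univ.erase u, |influence β γ E F u v| ≤
      (d + 1) * ((1 - d * edgeInfluence β γ z)⁻¹ * edgeInfluence β γ z) := by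
  have hβ := hp.beta_nonneg
  have hγ := hp.gamma_pos
  have hlt := hp.mul_lt_one
  have hc : 0 < (1 - d * edgeInfluence β γ z)⁻¹ := inv_pos.2 (by linarith)
  have hb := mul_nonneg hc.le (edgeInfluence_nonneg hβ hγ hlt hz.le)
  obtain ⟨p, q, h1, h2, h3, -⟩ := hdeg
  have hF0 : 0 < F u false := by rw [h2]; positivity
  have hF : ∀ b, F u b ≠ 0 := fun b => by cases b <;> [exact hF0.ne'; exact hF1.ne']
  obtain ⟨r, -, -, -, hs⟩ := exists_child_odds hctx hβ hγ hlt hb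
    (fun F' x _ hc' hd' hF' => influenceBound hp hz hfz hκ _ _ F' x (Nat.lt_succ_self _) hc' hd' hF')
    (nbrs E u) subset_rfl
  refine (sum_abs_influence_le hctx.loopless hF).trans (hs.trans ?_)
  have : (nbrs E u).card ≤ d + 1 := by omega
  exact mul_le_mul_of_nonneg_right (by exact_mod_cast this) hb

end Recursion

section Pinning

variable {V : Type*} [Fintype V] [DecidableEq V]

/-! ### Pinned Gibbs distributions -/

/-- Pinning the vertices of `L` according to `ρ` leaves, up to a constant factor, a system with
fields in which the vertices of `L` are isolated. -/
theorem exists_fieldWeight_pinned {β γ lam : ℝ} (hβ : 0 ≤ β) (hγ : 0 < γ) {D : ℕ}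
    {E : Finset (Sym2 V)} {F : V → Bool → ℝ} (hE : ∀ e ∈ E, ¬ e.IsDiag)
    (hF : ∀ x s, 0 ≤ F x s) (hdeg : ∀ x, HasDegree β γ lam E F D x) (ρ : V → Bool)
    (L : Finset V) :
    ∃ (k : ℝ) (E' : Finset (Sym2 V)) (F' : V → Bool → ℝ),
      (∀ σ, fieldWeight β γ E F σ * (if ∀ x ∈ L, σ x = ρ x then 1 else 0) =
        k * fieldWeight β γ E' F' σ) ∧
      (∀ e ∈ E', ¬ e.IsDiag) ∧ (∀ x s, 0 ≤ F' x s) ∧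
      (∀ x, x ∉ L → HasDegree β γ lam E' F' D x) ∧
      ∀ x ∈ L, nbrs E' x = ∅ ∧ 0 < F' x (ρ x) := by
  induction L using Finset.induction_on with
  | empty => exact ⟨1, E, F, by simp, hE, hF, fun x _ => hdeg x, by simp⟩
  | insert u L hu ih =>
    obtain ⟨k, E', F', h1, h2, h3, h4, h5⟩ := ih
    set K := if ρ u then nbrs E' u else ∅ with hK_def
    have hK : K ⊆ nbrs E' u := by
      rw [hK_def]; split_ifs <;> simp
    refine ⟨k * F' u (ρ u), deleteEdgesAt E' u, splitFields β γ F' u (ρ u) (nbrs E' u) K,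
      fun σ => ?_, fun e he => h2 e (Finset.mem_filter.1 he).1,
      fun x s => splitFields_nonneg hβ hγ h3 _ _ _ _ _ _, fun x hx => ?_, fun x hx => ?_⟩
    · rw [mul_assoc, ← fieldWeight_mul_indicator h2 F' u (ρ u) σ, ← mul_assoc, ← h1, mul_assoc]
      congr 1
      by_cases ha : σ u = ρ u <;> simp [ha]
    · rw [Finset.mem_insert, not_or] at hx
      exact (h4 x hx.2).splitFields hx.1 _ hK
    · rw [nbrs_deleteEdgesAt]
      by_cases hxu : x = u
      · subst hxu
        simp [splitFields]
      · obtain ⟨h6, h7⟩ := h5 x ((Finset.mem_insert.1 hx).resolve_left hxu)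
        have hxN : x ∉ nbrs E' u := fun h => by
          have := mem_nbrs_comm.1 h
          rw [h6] at this
          exact Finset.notMem_empty _ this
        have hxK : x ∉ K := fun h => hxN (hK h)
        simp [splitFields, hxu, hxN, hxK, h6, h7]

theorem weight_eq_fieldWeight (G : SimpleGraph V) [DecidableRel G.Adj] (β γ lam : ℝ)
    (σ : V → Bool) : weight G β γ lam σ =
      fieldWeight β γ G.edgeFinset (fun _ s => if s then lam else 1) σ := by
  have h : ∏ e ∈ G.edgeFinset, edgeWeight β γ σ e =
      β ^ monoEdges G true σ * γ ^ monoEdges G false σ := by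
    unfold edgeWeight monoEdges
    rw [Finset.prod_ite, Finset.prod_ite, Finset.prod_const, Finset.prod_const,
      Finset.prod_const_one, mul_one, Finset.filter_filter]
    congr 3
    refine Finset.filter_congr fun e _ => and_iff_right_of_imp fun h h' => ?_
    induction e with
    | _ a b =>
      have := h a (Sym2.mem_mk_left a b)
      rw [h' a (Sym2.mem_mk_left a b)] at this
      exact Bool.noConfusion this
  rw [weight, fieldWeight, h, mul_comm, Finset.prod_ite, Finset.prod_const, Finset.prod_const_one,
    mul_one]

end Pinning

/-! ### The influence matrix of a distribution -/

section Matrix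

variable {V : Type*} [Fintype V]

theorem prob_eq_sum_indicator [DecidableEq V] (μ : (V → Bool) → ℝ) (A : Set (V → Bool)) :
    prob μ A = ∑ σ, A.indicator μ σ := by
  classical
  rw [prob, Finset.sum_filter]
  refine Finset.sum_congr (by ext; simp) fun σ _ => ?_
  rw [Set.indicator_apply]

theorem prob_spinEvent [DecidableEq V] (μ : (V → Bool) → ℝ) (u : V) (b : Bool) :
    prob μ (spinEvent u b) = ∑ σ, μ σ * if σ u = b then 1 else 0 := by
  rw [prob_eq_sum_indicator]
  refine Finset.sum_congr rfl fun σ _ => ?_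
  by_cases h : σ u = b <;> simp [spinEvent, h]

theorem prob_condDist_spinEvent [DecidableEq V] (μ : (V → Bool) → ℝ) (u v : V) (b : Bool) :
    prob (condDist μ (spinEvent u b)) (spinEvent v true) =
      (∑ σ, μ σ * ((if σ u = b then 1 else 0) * if σ v = true then 1 else 0)) /
        ∑ σ, μ σ * if σ u = b then 1 else 0 := by
  rw [prob_spinEvent, Finset.sum_div]
  refine Finset.sum_congr rfl fun σ _ => ?_
  rw [condDist, prob_spinEvent]
  by_cases h : σ u = b <;> by_cases h' : σ v = true <;> simp [spinEvent, h, h']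

theorem sum_condDist [DecidableEq V] {μ : (V → Bool) → ℝ} {A : Set (V → Bool)}
    (h : prob μ A ≠ 0) : ∑ σ, condDist μ A σ = 1 := by
  simp only [condDist]
  rw [← Finset.sum_div, ← prob_eq_sum_indicator, div_self h]

/-- The influence matrix is diagonally similar to a symmetric matrix, the matrix of
correlations. -/
theorem splits_charpoly_influenceMatrix [DecidableEq V] {μ : (V → Bool) → ℝ} (h0 : ∀ σ, 0 ≤ μ σ)
    (h1 : ∑ σ, μ σ = 1) : (influenceMatrix μ).charpoly.Splits := by
  set p : V → ℝ := fun u => prob μ (spinEvent u true) with hp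
  set J : V → V → ℝ := fun u v =>
    ∑ σ, μ σ * ((if σ u = true then 1 else 0) * if σ v = true then 1 else 0) with hJ
  have hpe : ∀ u, p u = ∑ σ, μ σ * if σ u = true then 1 else 0 := fun u => prob_spinEvent μ u true
  have hJs : ∀ u v, J u v = J v u := fun u v =>
    Finset.sum_congr rfl fun σ _ => by rw [mul_comm (if σ u = true then (1 : ℝ) else 0)]
  have hJ0 : ∀ u v, 0 ≤ J u v := fun u v => Finset.sum_nonneg fun σ _ =>
    mul_nonneg (h0 σ) (by split_ifs <;> norm_num)
  have hJp : ∀ u v, J u v ≤ p v := fun u v => by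
    rw [hpe]
    refine Finset.sum_le_sum fun σ _ => mul_le_mul_of_nonneg_left ?_ (h0 σ)
    split_ifs <;> norm_num
  have hJ1 : ∀ u v, p u + p v - 1 ≤ J u v := fun u v => by
    have h2 : p u + p v - ∑ σ, μ σ ≤ J u v := by
      rw [hpe, hpe, ← Finset.sum_add_distrib, ← Finset.sum_sub_distrib]
      refine Finset.sum_le_sum fun σ _ => ?_
      have := h0 σ
      split_ifs <;> simp
      linarith
    rwa [h1] at h2
  have hfalse : ∀ u, ∑ σ, μ σ * (if σ u = false then 1 else 0) = 1 - p u := fun u => by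
    rw [eq_sub_iff_add_eq, hpe, ← Finset.sum_add_distrib]
    refine (Finset.sum_congr rfl fun σ _ => ?_).trans h1
    cases σ u <;> simp
  have hfalse' : ∀ u v, ∑ σ, μ σ * ((if σ u = false then 1 else 0) *
      if σ v = true then 1 else 0) = p v - J u v := fun u v => by
    rw [hpe, hJ, ← Finset.sum_sub_distrib]
    refine Finset.sum_congr rfl fun σ _ => ?_
    cases σ u <;> simp
  -- the variance, replaced by `1` at deterministic spins
  set d : V → ℝ := fun u => if p u ∈ Set.Ioo (0 : ℝ) 1 then p u * (1 - p u) else 1 with hd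
  have hdpos : ∀ u, 0 < d u := fun u => by
    simp only [hd]
    split_ifs with h
    · exact mul_pos h.1 (by linarith [h.2])
    · exact one_pos
  have hp0 : ∀ u, 0 ≤ p u := fun u => (hJ0 u u).trans (hJp u u)
  have hp1 : ∀ u, p u ≤ 1 := fun u => by
    have : 0 ≤ 1 - p u := by
      rw [← hfalse]
      exact Finset.sum_nonneg fun σ _ => mul_nonneg (h0 σ) (by split_ifs <;> norm_num)
    linarith
  -- deterministic spins are uncorrelated with all others
  have hdet : ∀ u v, p u ∉ Set.Ioo (0 : ℝ) 1 → J u v - p u * p v = 0 := fun u v h => by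
    have h2 := hJ0 u v
    have h3 := hJp u v
    have h4 := hJp v u
    have h5 := hJ1 u v
    rw [hJs v u] at h4
    rcases (hp0 u).eq_or_lt with e | e
    · rw [← e] at h4 ⊢; linarith
    · have : p u = 1 := le_antisymm (hp1 u) (not_lt.1 fun h' => h ⟨e, h'⟩)
      rw [this] at h5 ⊢; linarith
  have hΨ : ∀ u v, influenceMatrix μ u v =
      if u = v then 0 else (J u v - p u * p v) / d u := fun u v => by
    rw [influenceMatrix, Matrix.of_apply]
    by_cases huv : u = v
    · simp [huv]
    · by_cases hu : p u ∈ Set.Ioo (0 : ℝ) 1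
      · rw [if_pos ⟨hu, huv⟩, if_neg huv, prob_condDist_spinEvent, prob_condDist_spinEvent,
          hfalse, hfalse', ← hpe]
        have e1 : p u ≠ 0 := hu.1.ne'
        have e2 : 1 - p u ≠ 0 := by linarith [hu.2]
        simp only [hd, if_pos hu]
        change J u v / p u - _ = _
        field_simp
        ring
      · rw [if_neg fun h => hu h.1, if_neg huv, hdet u v hu, zero_div]
  set S : Matrix V V ℝ := Matrix.of fun u v =>
    if u = v then 0 else (J u v - p u * p v) / (√(d u) * √(d v)) with hS
  have hSH : S.IsHermitian := by
    refine Matrix.IsHermitian.ext fun u v => ?_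
    simp only [hS, Matrix.of_apply, star_trivial, hJs v u, eq_comm (a := v) (b := u),
      mul_comm (p v), mul_comm (√(d v))]
  have hsq : ∀ u, √(d u) ≠ 0 := fun u => (Real.sqrt_pos.2 (hdpos u)).ne'
  have hsim : influenceMatrix μ = Matrix.diagonal (fun u => (√(d u))⁻¹) *
      (S * Matrix.diagonal fun u => √(d u)) := by
    ext u v
    rw [Matrix.diagonal_mul, Matrix.mul_diagonal, hΨ, hS, Matrix.of_apply]
    split_ifs
    · simp
    · have := hsq u
      have := hsq v
      conv_lhs => rw [← Real.mul_self_sqrt (hdpos u).le]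
      field_simp
  have hone : Matrix.diagonal (fun u => √(d u)) * Matrix.diagonal (fun u => (√(d u))⁻¹) = 1 := by
    rw [Matrix.diagonal_mul_diagonal, ← Matrix.diagonal_one]
    congr 1
    funext u
    exact mul_inv_cancel₀ (hsq u)
  rw [hsim, Matrix.charpoly_mul_comm, Matrix.mul_assoc, hone, Matrix.mul_one]
  exact hSH.splits_charpoly

/-- A bound on the absolute row sums off a zero diagonal bounds the largest eigenvalue. -/
theorem lambdaMax_le_of_row_sum_le [DecidableEq V] {A : Matrix V V ℝ} {r : ℝ} (hr : 0 ≤ r)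
    (hdiag : ∀ u, A u u = 0) (h : ∀ u, ∑ v ∈ Finset.univ.erase u, |A u v| ≤ r) :
    lambdaMax A ≤ r := by
  refine Real.sSup_le (fun x hx => ?_) hr
  rw [← Matrix.spectrum_toLin', ← Module.End.hasEigenvalue_iff_mem_spectrum] at hx
  obtain ⟨u, hu⟩ := eigenvalue_mem_ball hx
  rw [Metric.mem_closedBall, hdiag, dist_zero_right] at hu
  exact (le_abs_self x).trans (hu.trans (h u))

end Matrix

/-! ### Row sums of the influence matrix of a pinned Gibbs distribution -/

/-- The bound at the fixed point, with `e` the edge influence there, in terms of the slack. -/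
theorem edgeInfluence_bound {Δ : ℕ} (hΔ : 3 ≤ Δ) {e δ : ℝ} (hδ : 0 < δ)
    (he : ((Δ - 1 : ℕ) : ℝ) * e ≤ 1 - δ) :
    (((Δ - 1 : ℕ) : ℝ) + 1) * ((1 - ((Δ - 1 : ℕ) : ℝ) * e)⁻¹ * e) ≤
      (Δ : ℝ) * (1 - δ) / (((Δ : ℝ) - 1) * δ) := by
  have hd : (((Δ - 1 : ℕ) : ℝ)) = (Δ : ℝ) - 1 := by
    rw [Nat.cast_sub (by omega)]; simp
  have h3 : (3 : ℝ) ≤ Δ := by exact_mod_cast hΔ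
  rw [hd] at he ⊢
  have h1 : 0 < 1 - ((Δ : ℝ) - 1) * e := by linarith
  have h2 : 0 < (Δ : ℝ) - 1 := by linarith
  have e1 : (Δ : ℝ) - 1 + 1 = Δ := by ring
  rw [e1, inv_mul_eq_div, mul_div_assoc', div_le_div_iff₀ h1 (by positivity)]
  have : (((Δ : ℝ) - 1) * e) * δ ≤ (1 - δ) * (1 - ((Δ : ℝ) - 1) * e) := by linarith
  calc (Δ : ℝ) * e * (((Δ : ℝ) - 1) * δ) = Δ * ((((Δ : ℝ) - 1) * e) * δ) := by ring
    _ ≤ Δ * ((1 - δ) * (1 - ((Δ : ℝ) - 1) * e)) := by gcongr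
    _ = _ := by ring

/-- Up to deterministic rows, the influence matrix of a pinned Gibbs distribution is that of a system
with fields in which the pinned vertices are isolated, so the recursion bounds its row sums. -/
theorem sum_abs_influenceMatrix_le {V : Type*} [Fintype V] [DecidableEq V]
    (G : SimpleGraph V) [DecidableRel G.Adj] {d : ℕ} {β γ lam z : ℝ}
    (hp : IsAntiferromagnetic β γ lam) (hz : 0 < z) (hfz : treeRec β γ lam d z = z)
    (hκ : d * edgeInfluence β γ z < 1) (hle : ∀ x, G.degree x ≤ d + 1)
    (hreg : 1 < γ → G.IsRegularOfDegree (d + 1)) {Λ : Set V} (τ : Λ → Bool)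
    (hτ : IsFeasible (gibbs G β γ lam) τ) (u : V) :
    ∑ v ∈ Finset.univ.erase u, |influenceMatrix (pinned (gibbs G β γ lam) τ) u v| ≤
      (d + 1) * ((1 - d * edgeInfluence β γ z)⁻¹ * edgeInfluence β γ z) := by
  classical
  have hβ := hp.beta_nonneg
  have hγ := hp.gamma_pos
  have hlt := hp.mul_lt_one
  have hlam := hp.lam_pos
  have hc : 0 < (1 - d * edgeInfluence β γ z)⁻¹ := inv_pos.2 (by linarith)
  have hb := mul_nonneg hc.le (edgeInfluence_nonneg hβ hγ hlt hz.le)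
  set ρ : V → Bool := fun x => if h : x ∈ Λ then τ ⟨x, h⟩ else false with hρ
  set L : Finset V := Finset.univ.filter (· ∈ Λ) with hL
  have hmemL : ∀ x, x ∈ L ↔ x ∈ Λ := fun x => by simp [hL]
  have hpin : ∀ σ : V → Bool, σ ∈ pinEvent τ ↔ ∀ x ∈ L, σ x = ρ x := fun σ => by
    constructor
    · intro h x hx
      have hx' := (hmemL x).1 hx
      simpa [hρ, hx'] using h ⟨x, hx'⟩
    · intro h x
      simpa [hρ, x.2] using h x ((hmemL x).2 x.2)
  have hnb : ∀ x, nbrs G.edgeFinset x = G.neighborFinset x := fun x => by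
    ext y; simp [mem_nbrs]
  obtain ⟨k, E, F, h1, h2, h3, h4, h5⟩ := exists_fieldWeight_pinned (β := β) (γ := γ) (lam := lam)
    hβ hγ (D := d + 1) (E := G.edgeFinset) (F := fun _ s => if s then lam else 1)
    (fun e he => G.not_isDiag_of_mem_edgeSet (SimpleGraph.mem_edgeFinset.1 he))
    (fun x s => by cases s <;> simp [hlam.le])
    (fun x => ⟨0, 0, by simp, by simp, by rw [hnb]; simpa using hle x, fun hg => by
      rw [hnb]; simpa using hreg hg x⟩) ρ L
  have hctx : IsContext β γ lam d E F u := ⟨h2, h3, fun x => by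
    by_cases hx : x ∈ L
    · exact ⟨ρ x, (h5 x hx).2, fun _ => (h5 x hx).1⟩
    · obtain ⟨p, q, -, h6, -⟩ := h4 x hx
      exact ⟨false, by rw [h6]; positivity, by simp⟩, fun x _ hx => h4 x fun hxL => by
        rw [(h5 x hxL).1] at hx
        exact Finset.not_nonempty_empty hx⟩
  set ν := pinned (gibbs G β γ lam) τ with hν
  obtain ⟨C, hC⟩ : ∃ C, ∀ σ, ν σ = C * fieldWeight β γ E F σ := by
    refine ⟨k / (∑ ω, weight G β γ lam ω) / prob (gibbs G β γ lam) (pinEvent τ), fun σ => ?_⟩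
    have e := h1 σ
    rw [← weight_eq_fieldWeight] at e
    have : (pinEvent τ).indicator (gibbs G β γ lam) σ =
        k * fieldWeight β γ E F σ / ∑ ω, weight G β γ lam ω := by
      rw [← e]
      by_cases hσ : σ ∈ pinEvent τ
      · rw [Set.indicator_of_mem hσ, if_pos ((hpin σ).1 hσ), mul_one, gibbs]
      · rw [Set.indicator_of_notMem hσ, if_neg fun h => hσ ((hpin σ).2 h), mul_zero, zero_div]
    rw [hν, pinned, condDist, this]
    ring
  have hsum : ∑ σ, ν σ = 1 := sum_condDist hτ.ne'
  have hC0 : C ≠ 0 := fun h => by simp [hC, h] at hsum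
  have hspin : ∀ b, (∑ σ, ν σ * if σ u = b then 1 else 0) = C * spinSum β γ E F u b := fun b => by
    simp only [hC, spinSum, Finset.mul_sum, mul_assoc]
  have hpair : ∀ b v, (∑ σ, ν σ * ((if σ u = b then 1 else 0) * if σ v = true then 1 else 0)) =
      C * pairSum β γ E F u b v := fun b v => by
    simp only [hC, pairSum, Finset.mul_sum, mul_assoc]
  by_cases hu : prob ν (spinEvent u true) ∈ Set.Ioo (0 : ℝ) 1
  · have hentry : ∀ v ∈ Finset.univ.erase u,
        |influenceMatrix ν u v| = |influence β γ E F u v| := fun v hv => by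
      rw [influenceMatrix, Matrix.of_apply, if_pos ⟨hu, (Finset.mem_erase.1 hv).1.symm⟩,
        prob_condDist_spinEvent, prob_condDist_spinEvent, hspin, hspin, hpair, hpair,
        mul_div_mul_left _ _ hC0, mul_div_mul_left _ _ hC0, influence]
    rw [Finset.sum_congr rfl hentry]
    rw [prob_spinEvent] at hu
    -- a pinned vertex has a deterministic spin
    have huL : u ∉ L := fun huL => by
      have hdet : ∀ σ, ν σ * (if σ u = true then 1 else 0) =
          ν σ * if ρ u = true then 1 else 0 := fun σ => by
        by_cases hσ : σ ∈ pinEvent τ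
        · rw [(hpin σ).1 hσ u huL]
        · simp [hν, pinned, condDist, Set.indicator_of_notMem hσ]
      simp only [hdet, ← Finset.sum_mul, hsum, one_mul] at hu
      split_ifs at hu <;> simp at hu
    refine sum_influence_le_of_isContext hp hz hfz hκ hctx (h4 u huL)
      ((h3 u true).lt_of_ne fun h => ?_)
    rw [hspin, spinSum_eq_splitFields h2, ← h] at hu
    simp at hu
  · refine le_trans (le_of_eq (Finset.sum_eq_zero fun v _ => ?_))
      (mul_nonneg (by positivity) hb)
    rw [influenceMatrix, Matrix.of_apply, if_neg fun h => hu h.1, abs_zero]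

end TwoSpin

theorem mainTheorem3 {V : Type*} [Fintype V] [DecidableEq V]
    (G : SimpleGraph V) [DecidableRel G.Adj] (Δ : ℕ) (hΔ : 3 ≤ Δ) (hmax : G.maxDegree = Δ)
    (β γ lam δ : ℝ) (hδ : δ ∈ Set.Ioo (0 : ℝ) 1)
    (hanti : TwoSpin.IsAntiferromagnetic β γ lam)
    (hle : γ ≤ 1 → TwoSpin.IsUniqueWithSlack β γ lam (Δ - 1) δ)
    (hgt : 1 < γ → TwoSpin.IsUniqueWithSlack β γ lam (Δ - 1) δ ∧ G.IsRegularOfDegree Δ)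
    (Λ : Set V) (τ : Λ → Bool) (hτ : TwoSpin.IsFeasible (TwoSpin.gibbs G β γ lam) τ) :
    (TwoSpin.influenceMatrix (TwoSpin.pinned (TwoSpin.gibbs G β γ lam) τ)).charpoly.Splits ∧
    TwoSpin.lambdaMax (TwoSpin.influenceMatrix (TwoSpin.pinned (TwoSpin.gibbs G β γ lam) τ)) ≤
      (Δ : ℝ) * (1 - δ) / (((Δ : ℝ) - 1) * δ) := by
  obtain ⟨z, hz, hfz, hderiv⟩ : TwoSpin.IsUniqueWithSlack β γ lam (Δ - 1) δ :=
    (le_or_gt γ 1).elim hle fun h => (hgt h).1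
  rw [TwoSpin.abs_deriv_treeRec hanti _ hz hfz] at hderiv
  have hκ : ((Δ - 1 : ℕ) : ℝ) * TwoSpin.edgeInfluence β γ z ≤ 1 - δ := by
    refine le_trans (le_of_eq ?_) hderiv
    rw [TwoSpin.edgeInfluence]
    ring
  have hd : Δ - 1 + 1 = Δ := by omega
  refine ⟨TwoSpin.splits_charpoly_influenceMatrix (fun σ => ?_) ?_,
    TwoSpin.lambdaMax_le_of_row_sum_le ?_ (fun u => ?_) fun u => ?_⟩
  · exact div_nonneg (Set.indicator_nonneg
      (fun σ _ => (TwoSpin.gibbs_isProbability G hanti).1 σ) σ) hτ.le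
  · exact TwoSpin.sum_condDist hτ.ne'
  · have h3 : (3 : ℝ) ≤ Δ := by exact_mod_cast hΔ
    exact div_nonneg (mul_nonneg (by linarith) (by linarith [hδ.2]))
      (mul_nonneg (by linarith) hδ.1.le)
  · simp [TwoSpin.influenceMatrix]
  · exact (TwoSpin.sum_abs_influenceMatrix_le G hanti hz hfz (by linarith [hδ.1])
      (fun x => by rw [hd, ← hmax]; exact G.degree_le_maxDegree x)
      (fun h => by rw [hd]; exact (hgt h).2) τ hτ u).trans
      (TwoSpin.edgeInfluence_bound hΔ hδ.1 hκ)
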